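/- Let $(R,\mathfrak m)$ be a Noetherian local ring that is catenary (for any primes $\mathfrak p\subseteq\mathfrak q$, all saturated chains of primes from $\mathfrak p$ to $\mathfrak q$ have the same length) and equidimensional ($\dim R/\mathfrak p=\dim R$ for every minimal prime $\mathfrak p$ of $R$). Let $I\subsetneq R$ be an ideal of height $c$ that is generically a complete intersection, i.e. for every associated prime $\mathfrak p\in\operatorname{Ass}_R(R/I)$ the ideal $I_{\mathfrak p}=IR_{\mathfrak p}$ is generated by a (possibly empty) $R_{\mathfrak p}$-regular sequence. For a Noetherian local ring $(A,\mathfrak n)$ of dimension $d$, let $$e(A)=\lim_{n\to\infty}\frac{d!\,\lambda_A(A/\mathfrak n^n)}{n^d}$$ denote its Hilbert–Samuel multiplicity with respect to $\mathfrak n$, where $\lambda_A$ is length. Then the limits defining $e(R/I)$ and $e(R/I^2)$ exist and $$e(R/I^2)=(c+1)\,e(R/I).$$ -/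

import Mathlib

open Filter Topology

/-- A commutative ring is catenary if, for any two primes `p ⊆ q`, all saturated chains of primes
from `p` to `q` have the same length. -/
def IsCatenaryRing (R : Type*) [CommRing R] : Prop :=
  ∀ s t : RelSeries {(p, q) : PrimeSpectrum R × PrimeSpectrum R | p ⋖ q},
    s.head = t.head → s.last = t.last → s.length = t.length

/-- A ring is equidimensional if `dim R/p = dim R` for every minimal prime `p`. -/
def IsEquidimensionalRing (R : Type*) [CommRing R] : Prop :=
  ∀ p ∈ minimalPrimes R, ringKrullDim (R ⧸ p) = ringKrullDim R

namespace Ideal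

/-- An ideal is a complete intersection if it is generated by a (possibly empty)
regular sequence. -/
def IsCompleteIntersection {R : Type*} [CommRing R] (I : Ideal R) : Prop :=
  ∃ rs : List R, RingTheory.Sequence.IsRegular R rs ∧ Ideal.ofList rs = I

/-- An ideal `I` is generically a complete intersection if `I_p` is a complete intersection ideal
of `R_p` for every associated prime `p` of `R/I`. -/
def IsGenericallyCompleteIntersection {R : Type*} [CommRing R] (I : Ideal R) : Prop :=
  ∀ (p : Ideal R) [p.IsPrime], p ∈ associatedPrimes R (R ⧸ I) →
    (I.map (algebraMap R (Localization.AtPrime p))).IsCompleteIntersection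

end Ideal

/-- The normalized Hilbert–Samuel function `n ↦ d! · λ(A/𝔪ⁿ) / n^d` of a local ring `(A, 𝔪)`
of dimension `d`. -/
noncomputable def hilbertSamuelQuotient (A : Type*) [CommRing A] [IsLocalRing A] (n : ℕ) : ℝ :=
  let d : ℕ := ((ringKrullDim A).unbotD 0).toNat
  (d.factorial : ℝ) * ((Module.length A (A ⧸ IsLocalRing.maximalIdeal A ^ n)).toNat : ℝ)
    / (n : ℝ) ^ d

/-- `e` is the Hilbert–Samuel multiplicity of the local ring `(A, 𝔪)` with respect to `𝔪`:
`e = lim_{n → ∞} d! · λ(A/𝔪ⁿ) / n^d`, where `d = dim A`. -/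
def HasHilbertSamuelMultiplicity (A : Type*) [CommRing A] [IsLocalRing A] (e : ℝ) : Prop :=
  Tendsto (hilbertSamuelQuotient A) atTop (𝓝 e)

/-- The Hilbert–Samuel multiplicity of a local ring with respect to its maximal ideal. -/
noncomputable def hilbertSamuelMultiplicity (A : Type*) [CommRing A] [IsLocalRing A] : ℝ :=
  limUnder atTop (hilbertSamuelQuotient A)

theorem Ideal.isLocalRing_quotient {R : Type*} [CommRing R] [IsLocalRing R] {I : Ideal R}
    (hI : I ≠ ⊤) : IsLocalRing (R ⧸ I) :=
  haveI : Nontrivial (R ⧸ I) := Ideal.Quotient.nontrivial_iff.mpr hI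
  IsLocalRing.of_surjective' (Ideal.Quotient.mk I) Ideal.Quotient.mk_surjective

theorem Ideal.ne_top_of_height_eq_natCast {R : Type*} [CommRing R] {I : Ideal R} {c : ℕ}
    (h : I.height = c) : I ≠ ⊤ := by
  rintro rfl
  simp at h

theorem Ideal.sq_ne_top {R : Type*} [CommRing R] {I : Ideal R} (h : I ≠ ⊤) : I ^ 2 ≠ ⊤ :=
  fun h' => h (top_le_iff.mp (h' ▸ Ideal.pow_le_self two_ne_zero))

/-! Let `d` be the common dimension of `R/I` and `R/I²`. The associativity formula
`Ideal.exists_hasHilbertSamuelLimit_sum` writes the limit of `λ(R/(J + 𝔪ⁿ))/n^d`, for every `J ⊇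
I²`, as a sum of `λ(R_P/J_P)·e(P)` over the minimal primes `P` of `I` with `dim R/P = d`. The
weights `e(P)` do not depend on `J`, so it suffices to compare the local lengths of `I²` and `I` at
each such `P`.

The dimension formula `IsCatenaryRing.height_add_ringKrullDim_quotient` gives each such `P` height
`c`, so `I_P` is generated by a regular sequence of length `c`. For an ideal `K` generated by a
regular sequence of length `c`, `λ(B/K²) = (c+1)·λ(B/K)` (`Ideal.colength_sq_span_eq`).

Limits exist because Hilbert–Samuel functions are eventually polynomial, of degree bounded through a
system of parameters. The formula follows by Noetherian induction, since both sides are additive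
along `J ↦ (J : a), J + (a)`. -/

/-! ### Colength and its additivity -/

section Colength

variable {R : Type*} [CommRing R]

theorem Module.length_eq_length_submodule_add_length_quotient {M : Type*} [AddCommGroup M]
    [Module R M] (P : Submodule R M) :
    Module.length R M = Module.length R P + Module.length R (M ⧸ P) :=
  Module.length_eq_add_of_exact P.subtype P.mkQ P.injective_subtype P.mkQ_surjective
    (LinearMap.exact_subtype_mkQ P)

namespace Ideal

/-- The colength of an ideal `J`, i.e. the length of `R ⧸ J`. -/
noncomputable def colength (J : Ideal R) : ℕ∞ := Module.length R (R ⧸ J)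

@[simp] theorem colength_top : colength (⊤ : Ideal R) = 0 := by
  unfold colength
  have : Subsingleton (R ⧸ (⊤ : Ideal R)) := Ideal.Quotient.subsingleton_iff.mpr rfl
  exact Module.length_eq_zero

theorem colength_anti {J K : Ideal R} (h : J ≤ K) : K.colength ≤ J.colength :=
  Module.length_le_of_surjective (Submodule.factor h) (Submodule.factor_surjective h)

theorem colength_eq_length_map_add {J K : Ideal R} (h : J ≤ K) :
    J.colength = Module.length R (Submodule.map (Submodule.mkQ J : R →ₗ[R] R ⧸ J) K)
      + K.colength := by
  unfold colength
  rw [Module.length_eq_length_submodule_add_length_quotient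
    (Submodule.map (Submodule.mkQ J : R →ₗ[R] R ⧸ J) K)]
  congr 1
  exact (Submodule.quotientQuotientEquivQuotient J K h).length_eq

/-- Multiplication by `a` induces an isomorphism `N/((J : a) ∩ N) ≅ (J + aN)/J`. The sum form avoids
subtraction in `ℕ∞`. -/
theorem colength_add_colength (J N : Ideal R) (a : R) :
    J.colength + N.colength =
      (J.colon {a} ⊓ N).colength + (J ⊔ Ideal.span {a} * N).colength := by
  set K := J.colon {a} ⊓ N with hK
  have hKN : K ≤ N := inf_le_right
  have hKa : ∀ y ∈ K, a * y ∈ J := fun y hy => by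
    have := Submodule.mem_colon_singleton.mp hy.1
    rwa [smul_eq_mul, mul_comm] at this
  rw [colength_eq_length_map_add hKN,
    colength_eq_length_map_add (le_sup_left : J ≤ J ⊔ Ideal.span {a} * N)]
  let φ : (R ⧸ K) →ₗ[R] (R ⧸ J) := Submodule.mapQ K J (LinearMap.mulLeft R a) hKa
  have key : Module.length R (Submodule.map (Submodule.mkQ K : R →ₗ[R] R ⧸ K) N) =
      Module.length R (Submodule.map (Submodule.mkQ J : R →ₗ[R] R ⧸ J)
        (J ⊔ Ideal.span {a} * N)) := by
    let ψ := φ.domRestrict (Submodule.map (Submodule.mkQ K : R →ₗ[R] R ⧸ K) N)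
    have hψ : Function.Injective ψ := by
      rw [← LinearMap.ker_eq_bot, LinearMap.ker_eq_bot']
      rintro ⟨_, y, hy, rfl⟩ h
      have h1 : (Submodule.mkQ J : R →ₗ[R] R ⧸ J) (a * y) = 0 := h
      rw [Submodule.mkQ_apply, Submodule.Quotient.mk_eq_zero] at h1
      ext
      simp only [Submodule.mkQ_apply, ZeroMemClass.coe_zero]
      rw [Submodule.Quotient.mk_eq_zero]
      exact ⟨Submodule.mem_colon_singleton.mpr (by rwa [smul_eq_mul, mul_comm]), hy⟩
    rw [(LinearEquiv.ofInjective ψ hψ).length_eq]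
    have : LinearMap.range ψ = Submodule.map (Submodule.mkQ J : R →ₗ[R] R ⧸ J)
        (J ⊔ Ideal.span {a} * N) := by
      apply le_antisymm
      · rintro _ ⟨⟨_, y, hy, rfl⟩, rfl⟩
        exact ⟨a * y, Ideal.mem_sup_right
          (Ideal.mul_mem_mul (Ideal.mem_span_singleton_self a) hy), rfl⟩
      · rintro _ ⟨z, hz, rfl⟩
        obtain ⟨j, hj, w, hw, rfl⟩ := Submodule.mem_sup.mp hz
        obtain ⟨y, hy, rfl⟩ := Ideal.mem_span_singleton_mul.mp hw
        refine ⟨⟨_, y, hy, rfl⟩, ?_⟩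
        have : (Submodule.mkQ J : R →ₗ[R] R ⧸ J) j = 0 :=
          (Submodule.Quotient.mk_eq_zero J).mpr hj
        rw [map_add, this, zero_add]
        rfl
    rw [this]
  rw [key]
  ring

theorem colength_eq_colon_add_sup (J : Ideal R) (a : R) :
    J.colength = (J.colon {a}).colength + (J ⊔ Ideal.span {a}).colength := by
  simpa using colength_add_colength J ⊤ a

theorem colength_ne_top_of_pow_le [IsNoetherianRing R] [IsLocalRing R] {J : Ideal R} {k : ℕ}
    (h : IsLocalRing.maximalIdeal R ^ k ≤ J) : J.colength ≠ ⊤ := by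
  by_cases hJ : J = ⊤
  · simp [hJ]
  have := Ideal.isLocalRing_quotient hJ
  have : IsArtinianRing (R ⧸ J) := by
    rw [isArtinianRing_iff_isNilpotent_maximalIdeal]
    refine ⟨k, ?_⟩
    rw [← IsLocalRing.map_maximalIdeal_of_surjective (Ideal.Quotient.mk J) Ideal.Quotient.mk_surjective,
      ← Ideal.map_pow, Ideal.zero_eq_bot, Ideal.map_eq_bot_iff_le_ker, Ideal.mk_ker]
    exact h
  have : IsArtinian R (R ⧸ J) :=
    isArtinian_of_surjective_algebraMap (S := R) (R := R ⧸ J) (M := R ⧸ J)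
      Ideal.Quotient.mk_surjective
  exact Module.length_ne_top

theorem length_quotient_maximalIdeal_pow [IsLocalRing R] {J : Ideal R} [IsLocalRing (R ⧸ J)] (n : ℕ) :
    Module.length (R ⧸ J) ((R ⧸ J) ⧸ IsLocalRing.maximalIdeal (R ⧸ J) ^ n) =
      (J ⊔ IsLocalRing.maximalIdeal R ^ n).colength := by
  rw [← IsLocalRing.map_maximalIdeal_of_surjective (Ideal.Quotient.mk J) Ideal.Quotient.mk_surjective,
    ← Ideal.map_pow, ← Module.length_eq_of_surjective (S := R) (R := R ⧸ J)
      Ideal.Quotient.mk_surjective]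
  exact (DoubleQuot.quotQuotEquivQuotSupₐ R J (IsLocalRing.maximalIdeal R ^ n)).toLinearEquiv.length_eq

end Ideal

end Colength

/-! ### Eventually polynomial functions -/

section EventuallyPolynomial

open Polynomial

/-- `f : ℕ → ℚ` agrees with a polynomial for large arguments. -/
def IsEventuallyPolynomial (f : ℕ → ℚ) : Prop :=
  ∃ P : ℚ[X], ∀ᶠ n : ℕ in atTop, f n = P.eval (n : ℚ)

namespace IsEventuallyPolynomial

theorem of_eventually_eq_zero {f : ℕ → ℚ} (h : ∀ᶠ n in atTop, f n = 0) :
    IsEventuallyPolynomial f :=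
  ⟨0, by simpa using h⟩

theorem add {f g : ℕ → ℚ} (hf : IsEventuallyPolynomial f) (hg : IsEventuallyPolynomial g) :
    IsEventuallyPolynomial (f + g) := by
  obtain ⟨P, hP⟩ := hf
  obtain ⟨Q, hQ⟩ := hg
  refine ⟨P + Q, ?_⟩
  filter_upwards [hP, hQ] with n h1 h2
  simp [h1, h2]

theorem comp_add_iff {f : ℕ → ℚ} (s : ℕ) :
    IsEventuallyPolynomial (fun n => f (n + s)) ↔ IsEventuallyPolynomial f := by
  constructor
  · rintro ⟨P, hP⟩
    refine ⟨P.comp (X - C (s : ℚ)), ?_⟩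
    have := (tendsto_sub_atTop_nat s).eventually hP
    filter_upwards [this, eventually_ge_atTop s] with n h1 h2
    rw [Nat.sub_add_cancel h2] at h1
    simp [h1, Nat.cast_sub h2]
  · rintro ⟨P, hP⟩
    refine ⟨P.comp (X + C (s : ℚ)), ?_⟩
    filter_upwards [(tendsto_add_atTop_nat s).eventually hP] with n h1
    simp [h1]

theorem exists_eval_add_one_sub_eq (Q : ℚ[X]) :
    ∃ P : ℚ[X], ∀ x, P.eval (x + 1) = P.eval x + Q.eval x := by
  induction Q using Polynomial.induction_on' with
  | add p q hp hq =>
    obtain ⟨P, hP⟩ := hp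
    obtain ⟨P', hP'⟩ := hq
    refine ⟨P + P', fun x => ?_⟩
    simp only [eval_add, hP, hP']
    ring
  | monomial n a =>
    -- Bernoulli polynomials satisfy `B_{n+1}(x+1) - B_{n+1}(x) = (n+1)xⁿ`.
    refine ⟨C (a / (n + 1)) * Polynomial.bernoulli (n + 1), fun x => ?_⟩
    have h : ((n : ℚ) + 1) ≠ 0 := by positivity
    rw [eval_mul, eval_mul, eval_C, add_comm x 1, bernoulli_eval_one_add, eval_monomial]
    simp
    field_simp

theorem of_sub {f g : ℕ → ℚ} (hg : IsEventuallyPolynomial g) (h : ∀ n, f (n + 1) = f n + g n) :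
    IsEventuallyPolynomial f := by
  obtain ⟨Q, hQ⟩ := hg
  obtain ⟨P, hP⟩ := exists_eval_add_one_sub_eq Q
  obtain ⟨N, hN⟩ := eventually_atTop.mp hQ
  refine ⟨P + C (f N - P.eval (N : ℚ)), eventually_atTop.mpr ⟨N, fun n hn => ?_⟩⟩
  induction n, hn using Nat.le_induction with
  | base => simp
  | succ n hn ih =>
    rw [h, ih, hN n hn]
    push_cast
    simp only [eval_add, eval_C, hP]
    ring

end IsEventuallyPolynomial

end EventuallyPolynomial

/-! ### Hilbert–Serre for the associated graded ring -/

section HilbertSerre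

open Polynomial

variable {R : Type*} [CommRing R]

/-- A family of ideals `m ^ (n + 1) ≤ J n ≤ m ^ n` with `m * J n ≤ J (n + 1)`, that is, a
homogeneous ideal of the associated graded ring of `m`. -/
structure IsGradedFamily (m : Ideal R) (J : ℕ → Ideal R) : Prop where
  pow_succ_le : ∀ n, m ^ (n + 1) ≤ J n
  le_pow : ∀ n, J n ≤ m ^ n
  mul_le : ∀ n, m * J n ≤ J (n + 1)

namespace IsGradedFamily

variable {m : Ideal R} {J : ℕ → Ideal R}

theorem pow_mul_le (hJ : IsGradedFamily m J) (i j : ℕ) : m ^ i * J j ≤ J (i + j) := by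
  induction i with
  | zero => simp
  | succ i ih =>
    calc m ^ (i + 1) * J j = m * (m ^ i * J j) := by rw [pow_succ', mul_assoc]
      _ ≤ m * J (i + j) := Ideal.mul_mono_right ih
      _ ≤ J (i + j + 1) := hJ.mul_le _
      _ = J (i + 1 + j) := by congr 1; ring

/-- The ideal of the Rees algebra defined by a graded family of ideals. -/
noncomputable def reesIdeal (hJ : IsGradedFamily m J) : Ideal (reesAlgebra m) where
  carrier := {f | ∀ n, (f : R[X]).coeff n ∈ J n}
  add_mem' hf hg n := by
    simpa using (J n).add_mem (hf n) (hg n)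
  zero_mem' n := by simp
  smul_mem' f g hg n := by
    simp only [smul_eq_mul, MulMemClass.coe_mul, coeff_mul]
    refine Ideal.sum_mem _ fun x hx => ?_
    rw [← Finset.HasAntidiagonal.mem_antidiagonal.mp hx]
    exact hJ.pow_mul_le _ _ (Ideal.mul_mem_mul (f.2 x.1) (hg x.2))

/-- The monomial `a Xⁿ` separates the two ideals. This transfers Noetherian induction from the Rees
algebra to graded families. -/
theorem reesIdeal_lt {J' : ℕ → Ideal R} (hJ : IsGradedFamily m J) (hJ' : IsGradedFamily m J')
    (hle : ∀ n, J n ≤ J' n) {n : ℕ} {a : R} (ha : a ∈ J' n) (ha' : a ∉ J n) :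
    hJ.reesIdeal < hJ'.reesIdeal := by
  refine lt_of_le_of_ne (fun f hf i => hle i (hf i)) fun h => ha' ?_
  have hmem : monomial n a ∈ reesAlgebra m := reesAlgebra.monomial_mem.mpr (hJ'.le_pow n ha)
  have h2 : (⟨monomial n a, hmem⟩ : reesAlgebra m) ∈ hJ'.reesIdeal := fun i => by
    simp only [coeff_monomial]
    split_ifs with hi
    · exact hi ▸ ha
    · simp
  rw [← h] at h2
  simpa using h2 n

/-- This adjoins the degree-`s` class of `a` to the homogeneous ideal. The truncation of `n - s` is
harmless: for `n < s`, already `a ∈ m ^ (n + 1) ≤ J n`. -/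
theorem sup_span (hJ : IsGradedFamily m J) {s : ℕ} {a : R} (ha : a ∈ m ^ s) :
    IsGradedFamily m (fun n => J n ⊔ Ideal.span {a} * m ^ (n - s)) where
  pow_succ_le n := (hJ.pow_succ_le n).trans le_sup_left
  le_pow n := by
    refine sup_le (hJ.le_pow n) ?_
    calc Ideal.span {a} * m ^ (n - s) ≤ m ^ s * m ^ (n - s) :=
          Ideal.mul_mono_left ((Ideal.span_singleton_le_iff_mem _).mpr ha)
      _ = m ^ (s + (n - s)) := (pow_add _ _ _).symm
      _ ≤ m ^ n := Ideal.pow_le_pow_right (by omega)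
  mul_le n := by
    rw [Ideal.mul_sup]
    refine sup_le_sup (hJ.mul_le n) ?_
    calc m * (Ideal.span {a} * m ^ (n - s)) = Ideal.span {a} * m ^ (n - s + 1) := by
          rw [pow_succ]; ring
      _ ≤ _ := Ideal.mul_mono_right (Ideal.pow_le_pow_right (by omega))

theorem colon_inf (hJ : IsGradedFamily m J) {s : ℕ} {a : R} (ha : a ∈ m ^ s) :
    IsGradedFamily m (fun n => (J (n + s)).colon {a} ⊓ m ^ n) where
  pow_succ_le n := by
    refine le_inf (fun y hy => Submodule.mem_colon_singleton.mpr ?_)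
      (Ideal.pow_le_pow_right (Nat.le_succ n))
    refine hJ.pow_succ_le _ ?_
    rw [show n + s + 1 = n + 1 + s by ring, pow_add]
    exact Ideal.mul_mem_mul hy ha
  le_pow n := inf_le_right
  mul_le n := by
    refine Ideal.mul_le.mpr fun r hr y hy => ⟨Submodule.mem_colon_singleton.mpr ?_, ?_⟩
    · have h1 := Submodule.mem_colon_singleton.mp hy.1
      have := hJ.mul_le _ (Ideal.mul_mem_mul hr h1)
      rw [show n + 1 + s = n + s + 1 by ring]
      simpa [mul_assoc] using this
    · rw [pow_succ']
      exact Ideal.mul_mem_mul hr hy.2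

theorem le_colon_inf (hJ : IsGradedFamily m J) {s : ℕ} {a : R} (ha : a ∈ m ^ s) (n : ℕ) :
    J n ≤ (J (n + s)).colon {a} ⊓ m ^ n := by
  refine le_inf (fun y hy => Submodule.mem_colon_singleton.mpr ?_) (hJ.le_pow n)
  have := hJ.pow_mul_le s n (Ideal.mul_mem_mul ha hy)
  rwa [smul_eq_mul, mul_comm, add_comm n s]

variable [IsNoetherianRing R] [IsLocalRing R]

local notation "𝔪" => IsLocalRing.maximalIdeal R

theorem colength_ne_top {J : ℕ → Ideal R} (hJ : IsGradedFamily 𝔪 J) (n : ℕ) :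
    (J n).colength ≠ ⊤ :=
  Ideal.colength_ne_top_of_pow_le (hJ.pow_succ_le n)

/-- The Hilbert function of a homogeneous ideal in the associated graded ring. -/
noncomputable def hilbertFunction (J : ℕ → Ideal R) (n : ℕ) : ℚ :=
  ((J n).colength.toNat : ℚ) - ((𝔪 ^ n).colength.toNat : ℚ)

theorem hilbertFunction_add (hJ : IsGradedFamily 𝔪 J) {s : ℕ} {a : R} (ha : a ∈ 𝔪 ^ s) (n : ℕ) :
    hilbertFunction J (n + s) = hilbertFunction (fun n => (J (n + s)).colon {a} ⊓ 𝔪 ^ n) n +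
      hilbertFunction (fun n => J n ⊔ Ideal.span {a} * 𝔪 ^ (n - s)) (n + s) := by
  have h := Ideal.colength_add_colength (J (n + s)) (𝔪 ^ n) a
  have h' := congrArg ENat.toNat h
  rw [ENat.toNat_add (hJ.colength_ne_top _) (Ideal.colength_ne_top_of_pow_le le_rfl),
    ENat.toNat_add ((hJ.colon_inf ha).colength_ne_top n)
      (ne_top_of_le_ne_top (hJ.colength_ne_top _) (Ideal.colength_anti le_sup_left))] at h'
  have h2 := congrArg (Nat.cast (R := ℚ)) h'
  push_cast at h2
  simp only [hilbertFunction, Nat.add_sub_cancel]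
  linarith

theorem isEventuallyPolynomial_hilbertFunction (hJ : IsGradedFamily 𝔪 J) :
    IsEventuallyPolynomial (hilbertFunction J) := by
  induction hI : hJ.reesIdeal using WellFoundedGT.induction generalizing J with
  | ind I ih =>
  subst hI
  -- If the homogeneous ideal is prime-like, either it contains all positive degrees, or a
  -- degree-one `x` is a nonzerodivisor modulo it and the first difference is a Hilbert function
  -- modulo a larger ideal. Otherwise a bad product `ab` yields two strictly larger ideals.
  by_cases hprime : ∀ s t a b, a ∈ 𝔪 ^ s → b ∈ 𝔪 ^ t → a * b ∈ J (s + t) → a ∈ J s ∨ b ∈ J t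
  · by_cases h1 : 𝔪 ≤ J 1
    · refine .of_eventually_eq_zero (eventually_atTop.mpr ⟨1, fun n hn => ?_⟩)
      have : J n = 𝔪 ^ n := by
        refine le_antisymm (hJ.le_pow n) ?_
        obtain ⟨k, rfl⟩ := Nat.exists_eq_add_of_le' hn
        rw [pow_succ]
        exact (Ideal.mul_mono_right h1).trans (hJ.pow_mul_le k 1)
      simp [hilbertFunction, this]
    · obtain ⟨x, hx, hxJ⟩ := SetLike.not_le_iff_exists.mp h1
      have hx1 : x ∈ 𝔪 ^ 1 := by simpa using hx
      have hS := hJ.sup_span hx1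
      have hxS : x ∈ J 1 ⊔ Ideal.span {x} * 𝔪 ^ (1 - 1) :=
        Ideal.mem_sup_right (by simp)
      have hpoly := ih _ (hJ.reesIdeal_lt hS (fun _ => le_sup_left) hxS hxJ) hS rfl
      refine .of_sub ((IsEventuallyPolynomial.comp_add_iff 1).mpr hpoly) fun n => ?_
      rw [hJ.hilbertFunction_add hx1 n]
      congr 1
      have : (J (n + 1)).colon {x} ⊓ 𝔪 ^ n = J n := by
        refine le_antisymm (fun y hy => ?_) (hJ.le_colon_inf hx1 n)
        exact (hprime n 1 y x hy.2 hx1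
          (by simpa using Submodule.mem_colon_singleton.mp hy.1)).resolve_right hxJ
      simp [hilbertFunction, this]
  · push Not at hprime
    obtain ⟨s, t, a, b, ha, hb, hab, haJ, hbJ⟩ := hprime
    have hS := hJ.sup_span ha
    have hC := hJ.colon_inf ha
    have haS : a ∈ J s ⊔ Ideal.span {a} * 𝔪 ^ (s - s) :=
      Ideal.mem_sup_right (by simp)
    have hbC : b ∈ (J (t + s)).colon {a} ⊓ 𝔪 ^ t :=
      ⟨Submodule.mem_colon_singleton.mpr (by rwa [smul_eq_mul, mul_comm, add_comm]), hb⟩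
    have h1 := ih _ (hJ.reesIdeal_lt hS (fun _ => le_sup_left) haS haJ) hS rfl
    have h2 := ih _ (hJ.reesIdeal_lt hC (hJ.le_colon_inf ha) hbC hbJ) hC rfl
    rw [← IsEventuallyPolynomial.comp_add_iff s]
    have := h2.add ((IsEventuallyPolynomial.comp_add_iff s).mpr h1)
    convert this using 1
    funext n
    exact hJ.hilbertFunction_add ha n

end IsGradedFamily

theorem IsLocalRing.isEventuallyPolynomial_colength_maximalIdeal_pow (R : Type*) [CommRing R]
    [IsNoetherianRing R] [IsLocalRing R] :
    IsEventuallyPolynomial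
      fun n => ((IsLocalRing.maximalIdeal R ^ n).colength.toNat : ℚ) := by
  -- This is the zero ideal of the graded ring; its Hilbert function is the first difference of
  -- `λ(R/𝔪ⁿ)`.
  have hJ : IsGradedFamily (IsLocalRing.maximalIdeal R)
      (fun n => IsLocalRing.maximalIdeal R ^ (n + 1)) :=
    ⟨fun n => le_rfl, fun n => Ideal.pow_le_pow_right (Nat.le_succ n),
      fun n => (pow_succ' _ _).ge⟩
  refine .of_sub hJ.isEventuallyPolynomial_hilbertFunction fun n => ?_
  simp [IsGradedFamily.hilbertFunction]

end HilbertSerre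

/-! ### Growth of the Hilbert–Samuel function -/

section HilbertSamuelFunction

open Polynomial

variable {R : Type*} [CommRing R] [IsLocalRing R]

local notation "𝔪" => IsLocalRing.maximalIdeal R

namespace Ideal

/-- The Hilbert–Samuel function `n ↦ λ(R / (J + 𝔪 ^ n))` of an ideal `J` of a local ring. -/
noncomputable def hilbertSamuelFunction (J : Ideal R) (n : ℕ) : ℕ :=
  (J ⊔ 𝔪 ^ n).colength.toNat

variable [IsNoetherianRing R]

theorem colength_sup_maximalIdeal_pow_ne_top (J : Ideal R) (n : ℕ) :
    (J ⊔ 𝔪 ^ n).colength ≠ ⊤ :=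
  colength_ne_top_of_pow_le le_sup_right

theorem hilbertSamuelFunction_eq_colon_add_sup (J : Ideal R) (x : R) (n : ℕ) :
    J.hilbertSamuelFunction n = ((J ⊔ 𝔪 ^ n).colon {x}).colength.toNat +
      (J ⊔ Ideal.span {x}).hilbertSamuelFunction n := by
  have h := congrArg ENat.toNat (colength_eq_colon_add_sup (J ⊔ 𝔪 ^ n) x)
  have h1 : ((J ⊔ 𝔪 ^ n).colon {x}).colength ≠ ⊤ :=
    ne_top_of_le_ne_top (colength_sup_maximalIdeal_pow_ne_top J n) (colength_anti le_colon)
  have h2 : J ⊔ 𝔪 ^ n ⊔ Ideal.span {x} = J ⊔ Ideal.span {x} ⊔ 𝔪 ^ n := sup_right_comm _ _ _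
  rw [h2, ENat.toNat_add h1 (colength_sup_maximalIdeal_pow_ne_top _ n)] at h
  exact h

theorem hilbertSamuelFunction_succ_le (J : Ideal R) {x : R} (hx : x ∈ 𝔪) (n : ℕ) :
    J.hilbertSamuelFunction (n + 1) ≤
      J.hilbertSamuelFunction n + (J ⊔ Ideal.span {x}).hilbertSamuelFunction (n + 1) := by
  rw [hilbertSamuelFunction_eq_colon_add_sup J x (n + 1)]
  gcongr
  refine ENat.toNat_le_toNat (colength_anti (sup_le ?_ ?_))
    (colength_sup_maximalIdeal_pow_ne_top J n)
  · exact le_sup_left.trans le_colon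
  · intro y hy
    refine Submodule.mem_colon_singleton.mpr (mem_sup_right ?_)
    rw [pow_succ]
    exact Ideal.mul_mem_mul hy hx

/-- Removing one generator bounds the first difference of the function by the function of `J + (x)`;
summing costs one power of `n`. -/
theorem exists_hilbertSamuelFunction_le (s : Finset R) (hs : ∀ x ∈ s, x ∈ 𝔪) {k : ℕ}
    (J : Ideal R) (h : 𝔪 ^ k ≤ J ⊔ Ideal.span (s : Set R)) :
    ∃ C : ℕ, ∀ n, J.hilbertSamuelFunction n ≤ C * (n + 1) ^ s.card := by
  classical
  induction s using Finset.induction_on generalizing J with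
  | empty =>
    refine ⟨J.colength.toNat, fun n => ?_⟩
    simp only [Finset.card_empty, pow_zero, mul_one]
    exact ENat.toNat_le_toNat (colength_anti le_sup_left)
      (colength_ne_top_of_pow_le (by simpa using h))
  | insert x s hxs ih =>
    obtain ⟨C, hC⟩ := ih (fun y hy => hs y (Finset.mem_insert_of_mem hy)) (J ⊔ Ideal.span {x})
      (by rwa [Finset.coe_insert, Ideal.span_insert, ← sup_assoc] at h)
    have hx : x ∈ 𝔪 := hs x (Finset.mem_insert_self x s)
    have key : ∀ n, J.hilbertSamuelFunction n ≤ C * (n + 1) ^ s.card * n := by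
      intro n
      induction n with
      | zero => simp [hilbertSamuelFunction]
      | succ n ihn =>
        calc J.hilbertSamuelFunction (n + 1)
            ≤ C * (n + 1) ^ s.card * n + C * (n + 1 + 1) ^ s.card :=
              (J.hilbertSamuelFunction_succ_le hx n).trans (add_le_add ihn (hC (n + 1)))
          _ ≤ C * (n + 1 + 1) ^ s.card * n + C * (n + 1 + 1) ^ s.card := by
              gcongr
              omega
          _ = C * (n + 1 + 1) ^ s.card * (n + 1) := by ring
    refine ⟨C, fun n => (key n).trans ?_⟩
    rw [Finset.card_insert_of_notMem hxs, pow_succ, mul_assoc]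
    gcongr
    omega

end Ideal

theorem Polynomial.exists_tendsto_eval_div_pow {P : ℝ[X]} {C : ℝ} {δ : ℕ}
    (hP : ∀ᶠ n : ℕ in atTop, |P.eval (n : ℝ)| ≤ C * ((n : ℝ) + 1) ^ δ) {d : ℕ} (hd : δ ≤ d) :
    ∃ e : ℝ, Tendsto (fun n : ℕ => P.eval (n : ℝ) / (n : ℝ) ^ d) atTop (𝓝 e) ∧
      (δ < d → e = 0) := by
  have hdeg : P.degree ≤ δ := by
    by_contra! hlt
    have hm : ((X + 1 : ℝ[X]) ^ δ).degree = δ := by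
      rw [degree_pow, show (X + 1 : ℝ[X]) = X + Polynomial.C 1 by simp, degree_X_add_C]
      simp
    have h := (abs_div_tendsto_atTop_atTop_of_degree_gt P ((X + 1) ^ δ) (hm ▸ hlt)
      (pow_ne_zero _ (X_add_C_ne_zero 1))).comp tendsto_natCast_atTop_atTop (α := ℕ)
    obtain ⟨n, h1, h2⟩ := ((h.eventually_gt_atTop C).and hP).exists
    simp only [Function.comp_apply, eval_pow, eval_add, eval_X, eval_one, abs_div] at h1
    rw [abs_of_pos (by positivity : (0 : ℝ) < ((n : ℝ) + 1) ^ δ), lt_div_iff₀ (by positivity)] at h1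
    linarith
  rcases lt_or_eq_of_le (hdeg.trans (Nat.cast_le.mpr hd) : P.degree ≤ d) with h | h
  · refine ⟨0, ?_, fun _ => rfl⟩
    have := (div_tendsto_atTop_zero_of_degree_lt P (X ^ d) (by simpa using h)).comp
      (tendsto_natCast_atTop_atTop (R := ℝ))
    simpa [Function.comp_def] using this
  · refine ⟨P.leadingCoeff, ?_, fun hlt => ?_⟩
    · have := (div_tendsto_atTop_leadingCoeff_div_of_degree_eq P (X ^ d) (by simpa using h)).comp
        (tendsto_natCast_atTop_atTop (R := ℝ))
      simpa [Function.comp_def] using this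
    · rw [h] at hdeg
      exact absurd (Nat.cast_le.mp hdeg) (by omega)

theorem IsLocalRing.exists_tendsto_colength_div_pow (R : Type*) [CommRing R] [IsNoetherianRing R]
    [IsLocalRing R] {d : ℕ} (hd : ringKrullDim R ≤ d) :
    ∃ e : ℝ, Tendsto (fun n : ℕ => ((IsLocalRing.maximalIdeal R ^ n).colength.toNat : ℝ) /
      (n : ℝ) ^ d) atTop (𝓝 e) ∧ (ringKrullDim R < d → e = 0) := by
  -- A system of parameters: `𝔪` is minimal over `(s)` and `s` has `dim R` elements.
  obtain ⟨s, hmin, hcard⟩ :=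
    (IsLocalRing.maximalIdeal R).exists_finset_card_eq_height_of_isNoetherianRing
  have hdim : ringKrullDim R = s.card := by
    rw [← IsLocalRing.maximalIdeal_height_eq_ringKrullDim, ← hcard]
    rfl
  have hs : ∀ x ∈ s, x ∈ IsLocalRing.maximalIdeal R :=
    fun x hx => hmin.1.2 (Ideal.subset_span hx)
  have := IsLocalRing.quotient_artinian_of_mem_minimalPrimes_of_isLocalRing _ hmin
  obtain ⟨k, hk⟩ := IsLocalRing.exists_maximalIdeal_pow_le_of_isArtinianRing_quotient
    (Ideal.span (s : Set R))
  obtain ⟨C, hC⟩ := Ideal.exists_hilbertSamuelFunction_le s hs (k := k) ⊥ (by simpa using hk)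
  obtain ⟨P, hP⟩ := IsLocalRing.isEventuallyPolynomial_colength_maximalIdeal_pow R
  have hPR : ∀ᶠ n : ℕ in atTop, ((IsLocalRing.maximalIdeal R ^ n).colength.toNat : ℝ) =
      (P.map (algebraMap ℚ ℝ)).eval (n : ℝ) := by
    filter_upwards [hP] with n hn
    have h1 := congrArg (algebraMap ℚ ℝ) hn
    rw [map_natCast] at h1
    rw [h1, ← eval_natCast_map]
  rw [hdim] at hd ⊢
  obtain ⟨e, he, he0⟩ := Polynomial.exists_tendsto_eval_div_pow (P := P.map (algebraMap ℚ ℝ))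
    (C := C) (δ := s.card) (d := d) (by
      filter_upwards [hPR] with n hn
      rw [← hn, abs_of_nonneg (by positivity)]
      have := hC n
      simp only [Ideal.hilbertSamuelFunction, bot_sup_eq] at this
      exact_mod_cast this) (by exact_mod_cast hd)
  refine ⟨e, he.congr' ?_, fun h => he0 (by exact_mod_cast h)⟩
  filter_upwards [hPR] with n hn
  rw [hn]

end HilbertSamuelFunction

/-! ### The associativity formula -/

section AssociativityFormula

theorem Filter.Tendsto.div_pow_comp_sub {f : ℕ → ℝ} {d : ℕ} {e : ℝ}
    (h : Tendsto (fun n : ℕ => f n / (n : ℝ) ^ d) atTop (𝓝 e)) (k : ℕ) :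
    Tendsto (fun n : ℕ => f (n - k) / (n : ℝ) ^ d) atTop (𝓝 e) := by
  have h1 := h.comp (tendsto_sub_atTop_nat k)
  have h2 : Tendsto (fun n : ℕ => ((n - k : ℕ) : ℝ) / (n : ℝ)) atTop (𝓝 1) := by
    have h3 : Tendsto (fun n : ℕ => 1 - (k : ℝ) / (n : ℝ)) atTop (𝓝 (1 - 0)) :=
      tendsto_const_nhds.sub (tendsto_const_div_atTop_nhds_zero_nat (k : ℝ))
    rw [sub_zero] at h3
    refine h3.congr' ?_
    filter_upwards [eventually_ge_atTop (k + 1)] with n hn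
    have : (n : ℝ) ≠ 0 := by
      have : n ≠ 0 := by omega
      exact_mod_cast this
    rw [Nat.cast_sub (by omega)]
    field_simp
  have h4 := h1.mul (h2.pow d)
  rw [one_pow, mul_one] at h4
  refine h4.congr' ?_
  filter_upwards [eventually_ge_atTop (k + 1)] with n hn
  have h5 : ((n - k : ℕ) : ℝ) ≠ 0 := by
    have : n - k ≠ 0 := by omega
    exact_mod_cast this
  simp only [Function.comp_apply]
  rw [div_pow]
  field_simp

variable {R : Type*} [CommRing R]

namespace Ideal

theorem map_colon_singleton_of_isLocalization (M : Submonoid R) (S : Type*) [CommRing S]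
    [Algebra R S] [IsLocalization M S] (J : Ideal R) (a : R) :
    (J.colon {a}).map (algebraMap R S) = (J.map (algebraMap R S)).colon {algebraMap R S a} := by
  apply le_antisymm
  · refine Ideal.map_le_iff_le_comap.mpr fun y hy => Submodule.mem_colon_singleton.mpr ?_
    rw [smul_eq_mul, ← map_mul]
    exact Ideal.mem_map_of_mem _ (Submodule.mem_colon_singleton.mp hy)
  · intro z hz
    obtain ⟨⟨y, s⟩, hys⟩ := IsLocalization.surj M z
    have h1 : algebraMap R S (y * a) ∈ J.map (algebraMap R S) := by
      have := Ideal.mul_mem_left _ (algebraMap R S s) (Submodule.mem_colon_singleton.mp hz)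
      simp only at hys
      rw [map_mul, ← hys]
      convert this using 1
      rw [smul_eq_mul]
      ring
    obtain ⟨t, ht, hty⟩ := (IsLocalization.algebraMap_mem_map_algebraMap_iff M S _ _).mp h1
    have h2 : t * y ∈ J.colon {a} := Submodule.mem_colon_singleton.mpr (by
      rwa [smul_eq_mul, mul_assoc])
    have h3 := Ideal.mem_map_of_mem (algebraMap R S) h2
    rw [map_mul, Ideal.unit_mul_mem_iff_mem _ (IsLocalization.map_units S ⟨t, ht⟩)] at h3
    rw [← Ideal.mul_unit_mem_iff_mem _ (IsLocalization.map_units S s), hys]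
    exact h3

theorem ringKrullDim_quotient_asIdeal (P : PrimeSpectrum R) :
    ringKrullDim (R ⧸ P.asIdeal) = Order.coheight P := by
  rw [ringKrullDim_quotient, Order.coheight_eq_krullDim_Ici]
  congr 2

theorem ringKrullDim_quotient_add_one_le_of_lt {p q : Ideal R} [hp : p.IsPrime] [hq : q.IsPrime]
    (h : p < q) : ringKrullDim (R ⧸ q) + 1 ≤ ringKrullDim (R ⧸ p) := by
  have h1 := Order.coheight_add_one_le (show (⟨p, hp⟩ : PrimeSpectrum R) < ⟨q, hq⟩ from h)
  rw [ringKrullDim_quotient_asIdeal ⟨q, hq⟩, ringKrullDim_quotient_asIdeal ⟨p, hp⟩]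
  exact_mod_cast h1

/-- The colength of the localization of an ideal at a prime. -/
noncomputable def localColength (P : PrimeSpectrum R) (J : Ideal R) : ℕ∞ :=
  (J.map (algebraMap R (Localization.AtPrime P.asIdeal))).colength

theorem localColength_eq_colon_add_sup (P : PrimeSpectrum R) (J : Ideal R) (a : R) :
    localColength P J = localColength P (J.colon {a}) + localColength P (J ⊔ Ideal.span {a}) := by
  unfold localColength
  rw [colength_eq_colon_add_sup _ (algebraMap R (Localization.AtPrime P.asIdeal) a),
    map_colon_singleton_of_isLocalization P.asIdeal.primeCompl, Ideal.map_sup, Ideal.map_span,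
    Set.image_singleton]

theorem localColength_eq_zero {P : PrimeSpectrum R} {J : Ideal R} (h : ¬ J ≤ P.asIdeal) :
    localColength P J = 0 := by
  unfold localColength
  obtain ⟨x, hxJ, hxP⟩ := SetLike.not_le_iff_exists.mp h
  rw [Ideal.eq_top_of_isUnit_mem _ (Ideal.mem_map_of_mem _ hxJ)
    (IsLocalization.map_units _ (⟨x, hxP⟩ : P.asIdeal.primeCompl)), colength_top]

theorem localColength_self (P : PrimeSpectrum R) : localColength P P.asIdeal = 1 := by
  unfold localColength
  rw [Localization.AtPrime.map_eq_maximalIdeal, colength, Module.length_eq_one_iff]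
  exact isSimpleModule_iff_isCoatom.mpr (IsLocalRing.maximalIdeal.isMaximal _).out

/-- Artin–Rees for the cyclic submodule generated by `a` in `R/J`: if `ya ∈ J + mⁿ`, then `ya ≡ za`
modulo `J` with `z ∈ m ^ (n - k)`, so `y - z ∈ (J : a)`. -/
theorem exists_colon_sup_pow_le [IsNoetherianRing R] (m J : Ideal R) (a : R) :
    ∃ k, ∀ n ≥ k, (J ⊔ m ^ n).colon {a} ≤ J.colon {a} ⊔ m ^ (n - k) := by
  obtain ⟨k, hk⟩ := Ideal.exists_pow_inf_eq_pow_smul m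
    (Submodule.span R {(Ideal.Quotient.mk J a : R ⧸ J)})
  refine ⟨k, fun n hn y hy => ?_⟩
  have hy' := Submodule.mem_colon_singleton.mp hy
  obtain ⟨j, hj, w, hw, hjw⟩ := Submodule.mem_sup.mp hy'
  have h1 : Ideal.Quotient.mk J (y * a) ∈ m ^ n • (⊤ : Submodule R (R ⧸ J)) := by
    have : Ideal.Quotient.mk J (y * a) = w • (1 : R ⧸ J) := by
      rw [Algebra.smul_def, mul_one, Ideal.Quotient.algebraMap_eq, ← smul_eq_mul, ← hjw, map_add,
        Ideal.Quotient.eq_zero_iff_mem.mpr hj, zero_add]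
    rw [this]
    exact Submodule.smul_mem_smul hw trivial
  have h2 : Ideal.Quotient.mk J (y * a) ∈ Submodule.span R {(Ideal.Quotient.mk J a : R ⧸ J)} :=
    Submodule.mem_span_singleton.mpr ⟨y, by
      rw [Algebra.smul_def, Ideal.Quotient.algebraMap_eq, map_mul]⟩
  have h3 : Ideal.Quotient.mk J (y * a) ∈
      m ^ (n - k) • Submodule.span R {(Ideal.Quotient.mk J a : R ⧸ J)} :=
    Submodule.smul_mono le_rfl inf_le_right ((hk n hn).le ⟨h1, h2⟩)
  obtain ⟨z, hz, hza⟩ := Submodule.mem_smul_span_singleton.mp h3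
  rw [Algebra.smul_def, Ideal.Quotient.algebraMap_eq, ← map_mul, eq_comm, Ideal.Quotient.eq,
    ← sub_mul] at hza
  rw [← sub_add_cancel y z]
  exact Ideal.add_mem _ (mem_sup_left (Submodule.mem_colon_singleton.mpr hza)) (mem_sup_right hz)

/-- The primes `P` minimal over `J` with `dim R/P = d`. -/
def minimalPrimesOfDim (J : Ideal R) (d : ℕ) : Set (PrimeSpectrum R) :=
  {P | P.asIdeal ∈ J.minimalPrimes ∧ ringKrullDim (R ⧸ P.asIdeal) = d}

theorem finite_minimalPrimesOfDim [IsNoetherianRing R] (J : Ideal R) (d : ℕ) : (J.minimalPrimesOfDim d).Finite :=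
  ((J.finite_minimalPrimes_of_isNoetherianRing).preimage
    (fun _ _ _ _ h => PrimeSpectrum.ext h)).subset fun _ hP => hP.1

variable [IsNoetherianRing R] [IsLocalRing R]

local notation "𝔪" => IsLocalRing.maximalIdeal R

/-- `e` is the limit of the Hilbert–Samuel function of `J`, divided by `n ^ d`. -/
def HasHilbertSamuelLimit (d : ℕ) (J : Ideal R) (e : ℝ) : Prop :=
  Tendsto (fun n : ℕ => (J.hilbertSamuelFunction n : ℝ) / (n : ℝ) ^ d) atTop (𝓝 e)

/-- The error term `(J + 𝔪ⁿ) : a` lies between `(J : a) + 𝔪ⁿ` and `(J : a) + 𝔪ⁿ⁻ᵏ`, and a bounded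
shift does not affect the limit. -/
theorem HasHilbertSamuelLimit.of_colon_of_sup {d : ℕ} {J : Ideal R} {a : R} {e₁ e₂ : ℝ}
    (h₁ : HasHilbertSamuelLimit d (J.colon {a}) e₁)
    (h₂ : HasHilbertSamuelLimit d (J ⊔ Ideal.span {a}) e₂) :
    HasHilbertSamuelLimit d J (e₁ + e₂) := by
  obtain ⟨k, hk⟩ := exists_colon_sup_pow_le 𝔪 J a
  have key : Tendsto (fun n : ℕ => (((J ⊔ 𝔪 ^ n).colon {a}).colength.toNat : ℝ) / (n : ℝ) ^ d)
      atTop (𝓝 e₁) := by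
    refine tendsto_of_tendsto_of_tendsto_of_le_of_le' (Tendsto.div_pow_comp_sub h₁ k) h₁ ?_ ?_
    · filter_upwards [eventually_ge_atTop k] with n hn
      gcongr
      exact ENat.toNat_le_toNat (colength_anti (hk n hn))
        (ne_top_of_le_ne_top (colength_sup_maximalIdeal_pow_ne_top J n) (colength_anti le_colon))
    · filter_upwards with n
      gcongr
      refine ENat.toNat_le_toNat (colength_anti (sup_le ?_ ?_))
        (colength_sup_maximalIdeal_pow_ne_top _ n)
      · exact Submodule.colon_mono le_sup_left le_rfl
      · exact le_sup_right.trans le_colon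
  refine (key.add h₂).congr fun n => ?_
  rw [← add_div, hilbertSamuelFunction_eq_colon_add_sup J a n]
  push_cast
  rfl

theorem exists_hasHilbertSamuelLimit_of_ne_top {d : ℕ} (J : Ideal R) (hJ : J ≠ ⊤)
    (hd : ringKrullDim (R ⧸ J) ≤ d) :
    ∃ e, HasHilbertSamuelLimit d J e ∧ (ringKrullDim (R ⧸ J) < d → e = 0) := by
  have := Ideal.isLocalRing_quotient hJ
  obtain ⟨e, he, he0⟩ := IsLocalRing.exists_tendsto_colength_div_pow (R ⧸ J) hd
  refine ⟨e, ?_, he0⟩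
  refine he.congr fun n => ?_
  rw [hilbertSamuelFunction, colength, length_quotient_maximalIdeal_pow]

/-- The associativity formula for the leading coefficient of the Hilbert–Samuel function. -/
theorem exists_hasHilbertSamuelLimit_sum (J₀ : Ideal R) (d : ℕ) (hd : ringKrullDim (R ⧸ J₀) ≤ d) :
    ∃ e : PrimeSpectrum R → ℝ, ∀ J : Ideal R, J₀ ≤ J →
      (∀ P ∈ J₀.minimalPrimesOfDim d, localColength P J ≠ ⊤) ∧
      HasHilbertSamuelLimit d J
        (∑ P ∈ (J₀.finite_minimalPrimesOfDim d).toFinset, (localColength P J).toNat * e P) := by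
  classical
  have hdim : ∀ J : Ideal R, J₀ ≤ J → ringKrullDim (R ⧸ J) ≤ d := fun J hJ =>
    (ringKrullDim_le_of_surjective _ (Ideal.Quotient.factor_surjective hJ)).trans hd
  have hex : ∀ P : PrimeSpectrum R, ∃ e : ℝ, J₀ ≤ P.asIdeal →
      HasHilbertSamuelLimit d P.asIdeal e ∧ (ringKrullDim (R ⧸ P.asIdeal) < d → e = 0) := fun P => by
    by_cases hP : J₀ ≤ P.asIdeal
    · obtain ⟨e, he⟩ := exists_hasHilbertSamuelLimit_of_ne_top P.asIdeal P.2.ne_top (hdim _ hP)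
      exact ⟨e, fun _ => he⟩
    · exact ⟨0, fun h => absurd h hP⟩
  choose e he using hex
  refine ⟨e, fun J => ?_⟩
  induction J using WellFoundedGT.induction with
  | ind J ih =>
  intro hJ
  by_cases hprime : J.IsPrime
  · set Q : PrimeSpectrum R := ⟨J, hprime⟩ with hQ
    obtain ⟨h1, h2⟩ := he Q hJ
    have hloc : ∀ P ∈ J₀.minimalPrimesOfDim d, localColength P J = if P = Q then 1 else 0 := by
      intro P hP
      split_ifs with h
      · subst h
        exact localColength_self Q
      · refine localColength_eq_zero fun hle => h (PrimeSpectrum.ext ?_)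
        exact le_antisymm (hP.1.2 ⟨hprime, hJ⟩ hle) hle
    refine ⟨fun P hP => ?_, ?_⟩
    · rw [hloc P hP]
      split_ifs <;> simp
    · have hsum : ∑ P ∈ (J₀.finite_minimalPrimesOfDim d).toFinset,
          ((localColength P J).toNat : ℝ) * e P = e Q := by
        rw [Finset.sum_congr rfl (g := fun P => if P = Q then e P else 0)]
        · rw [Finset.sum_ite_eq']
          split_ifs with hmem
          · rfl
          · rw [Set.Finite.mem_toFinset] at hmem
            -- If `Q` is outside the index set, then `dim R/Q < d` and `e Q = 0`: a nonminimal `Q`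
            -- of dimension `d` would lie over a prime of dimension greater than `d`.
            refine (h2 (lt_of_le_of_ne (hdim J hJ) fun heq => hmem ⟨?_, heq⟩)).symm
            obtain ⟨p, hp, hpJ⟩ := Ideal.exists_minimalPrimes_le hJ
            rcases eq_or_lt_of_le hpJ with h | h
            · exact (show p = Q.asIdeal from h) ▸ hp
            · exfalso
              have := hp.1.1
              have h3 := (ringKrullDim_quotient_add_one_le_of_lt h).trans (hdim p hp.1.2)
              have h4 : ringKrullDim (R ⧸ J) = d := heq
              rw [h4] at h3
              have : d + 1 ≤ d := by exact_mod_cast h3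
              omega
        · intro P hP
          rw [hloc P ((Set.Finite.mem_toFinset _).mp hP)]
          split_ifs <;> simp
      rw [hsum]
      exact h1
  by_cases htop : J = ⊤
  · subst htop
    refine ⟨fun P _ => ?_, ?_⟩
    · simp [localColength, Ideal.map_top]
    · simp [localColength, Ideal.map_top, HasHilbertSamuelLimit, hilbertSamuelFunction]
  -- Both `J : a`, which contains `b`, and `J + (a)` are strictly larger than `J`, so induction
  -- applies to each.
  obtain ⟨a, b, hab, haJ, hbJ⟩ : ∃ a b, a * b ∈ J ∧ a ∉ J ∧ b ∉ J := by
    by_contra! h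
    exact hprime ⟨htop, fun {x y} hxy => or_iff_not_imp_left.mpr fun hx => h x y hxy hx⟩
  have hb : b ∈ J.colon {a} := Submodule.mem_colon_singleton.mpr (by rwa [smul_eq_mul, mul_comm])
  have ha : a ∈ J ⊔ Ideal.span {a} := mem_sup_right (mem_span_singleton_self a)
  obtain ⟨hc1, hc2⟩ := ih _ (SetLike.lt_iff_le_and_exists.mpr ⟨le_colon, b, hb, hbJ⟩)
    (hJ.trans le_colon)
  obtain ⟨hs1, hs2⟩ := ih _ (SetLike.lt_iff_le_and_exists.mpr ⟨le_sup_left, a, ha, haJ⟩)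
    (hJ.trans le_sup_left)
  refine ⟨fun P hP => ?_, ?_⟩
  · rw [localColength_eq_colon_add_sup P J a]
    exact WithTop.add_ne_top.mpr ⟨hc1 P hP, hs1 P hP⟩
  · have := hc2.of_colon_of_sup hs2
    rw [← Finset.sum_add_distrib] at this
    convert this using 1
    refine Finset.sum_congr rfl fun P hP => ?_
    have hP' := (Set.Finite.mem_toFinset _).mp hP
    rw [localColength_eq_colon_add_sup P J a, ENat.toNat_add (hc1 P hP') (hs1 P hP')]
    push_cast
    ring

end Ideal

end AssociativityFormula

/-! ### Saturated chains and the dimension formula -/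

section Catenary

theorem Order.exists_covBy_series_of_height_eq {α : Type*} [PartialOrder α] {n : ℕ} {x : α}
    (h : Order.height x = n) :
    ∃ s : RelSeries {(a, b) : α × α | a ⋖ b}, s.last = x ∧ s.length = n ∧ IsMin s.head := by
  induction n generalizing x with
  | zero => exact ⟨RelSeries.singleton _ x, rfl, rfl, Order.height_eq_zero.mp h⟩
  | succ n ih =>
    push_cast at h
    obtain ⟨-, ⟨y, hyx, hy⟩, hle⟩ := Order.height_eq_coe_add_one_iff.mp h
    obtain ⟨s, rfl, hs, hmin⟩ := ih hy
    -- An element strictly between would have height above `n`, forcing the height of `x` above `n +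
    -- 1`.
    have hcov : s.last ⋖ x := by
      refine ⟨hyx, fun z hz hzx => ?_⟩
      have h1 := (Order.height_add_one_le hz).trans (hle z hzx)
      rw [hy] at h1
      have : n + 1 ≤ n := by exact_mod_cast h1
      omega
    refine ⟨s.snoc x hcov, by simp, ?_, by simpa using hmin⟩
    rw [← hs]
    rfl

theorem Order.exists_covBy_series_of_coheight_eq {α : Type*} [PartialOrder α] {n : ℕ} {x : α}
    (h : Order.coheight x = n) :
    ∃ s : RelSeries {(a, b) : α × α | a ⋖ b}, s.head = x ∧ s.length = n ∧ IsMax s.last := by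
  induction n generalizing x with
  | zero => exact ⟨RelSeries.singleton _ x, rfl, rfl, Order.coheight_eq_zero.mp h⟩
  | succ n ih =>
    push_cast at h
    obtain ⟨-, ⟨y, hyx, hy⟩, hle⟩ := Order.coheight_eq_coe_add_one_iff.mp h
    obtain ⟨s, rfl, hs, hmax⟩ := ih hy
    have hcov : x ⋖ s.head := by
      refine ⟨hyx, fun z hz hzx => ?_⟩
      have h1 := (Order.coheight_add_one_le hzx).trans (hle z hz)
      rw [hy] at h1
      have : n + 1 ≤ n := by exact_mod_cast h1
      omega
    refine ⟨s.cons x hcov, by simp, ?_, by simpa using hmax⟩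
    rw [← hs]
    change 0 + s.length + 1 = _
    omega

variable {R : Type*} [CommRing R] [IsLocalRing R]

theorem IsLocalRing.eq_closedPoint_of_isMax {P : PrimeSpectrum R} (h : IsMax P) :
    P = IsLocalRing.closedPoint R :=
  have hle : P ≤ IsLocalRing.closedPoint R := IsLocalRing.le_maximalIdeal P.2.ne_top
  le_antisymm hle (h hle)

/-- The dimension formula in a catenary equidimensional Noetherian local ring. -/
theorem IsCatenaryRing.height_add_ringKrullDim_quotient [IsNoetherianRing R] (hcat : IsCatenaryRing R)
    (hequi : IsEquidimensionalRing R) (P : PrimeSpectrum R) :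
    (P.asIdeal.height : WithBot ℕ∞) + ringKrullDim (R ⧸ P.asIdeal) = ringKrullDim R := by
  have hfin : ∀ Q : PrimeSpectrum R, Order.coheight Q ≠ ⊤ := fun Q h => by
    have h1 := ringKrullDim_quotient_le Q.asIdeal
    rw [Ideal.ringKrullDim_quotient_asIdeal, h] at h1
    exact (not_lt_of_ge h1) ringKrullDim_lt_top
  have hfin' : Order.height P ≠ ⊤ := by
    rw [← PrimeSpectrum.height_eq_orderHeight]
    exact Ideal.height_ne_top P.2.ne_top
  obtain ⟨a, ha⟩ := ENat.ne_top_iff_exists.mp hfin'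
  obtain ⟨b, hb⟩ := ENat.ne_top_iff_exists.mp (hfin P)
  obtain ⟨s, hs1, hs2, hs3⟩ := Order.exists_covBy_series_of_height_eq ha.symm
  obtain ⟨t, ht1, ht2, ht3⟩ := Order.exists_covBy_series_of_coheight_eq hb.symm
  obtain ⟨D, hD⟩ := ENat.ne_top_iff_exists.mp (hfin s.head)
  obtain ⟨u, hu1, hu2, hu3⟩ := Order.exists_covBy_series_of_coheight_eq hD.symm
  -- Two saturated chains from the same minimal prime to the maximal ideal: one through `P`, one of
  -- length `dim R/s.head`.
  have hlen := hcat (s.smash t (hs1.trans ht1.symm)) u (by simp [hu1])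
    (by simp [IsLocalRing.eq_closedPoint_of_isMax ht3, IsLocalRing.eq_closedPoint_of_isMax hu3])
  have hsum : a + b = D := by
    rw [← hs2, ← ht2, ← hu2]
    exact hlen
  have hmin : s.head.asIdeal ∈ minimalPrimes R := by
    rw [← Ideal.height_eq_zero_iff, PrimeSpectrum.height_eq_orderHeight, Order.height_eq_zero]
    exact hs3
  rw [← hequi _ hmin, Ideal.ringKrullDim_quotient_asIdeal, Ideal.ringKrullDim_quotient_asIdeal,
    PrimeSpectrum.height_eq_orderHeight, ← ha, ← hb, ← hD, ← hsum]
  push_cast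
  rfl

end Catenary

/-! ### Squares of ideals generated by regular sequences -/

section RegularSequence

open Finset

variable {B : Type*} [CommRing B]

theorem Ideal.mem_span_image_range_iff {x : ℕ → B} {k : ℕ} {z : B} :
    z ∈ Ideal.span (x '' (range k : Set ℕ)) ↔ ∃ c : ℕ → B, ∑ j ∈ range k, c j * x j = z := by
  constructor
  · intro hz
    obtain ⟨c, rfl⟩ := (Submodule.mem_span_image_finset_iff_exists_fun B).mp hz
    refine ⟨fun j => if h : j ∈ range k then c ⟨j, h⟩ else 0, ?_⟩
    rw [← sum_coe_sort (range k)]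
    exact sum_congr rfl fun j _ => by simp only [j.2, dite_true, smul_eq_mul]
  · rintro ⟨c, rfl⟩
    exact Ideal.sum_mem _ fun j hj =>
      Ideal.mul_mem_left _ _ (Ideal.subset_span ⟨j, mem_coe.mpr hj, rfl⟩)

theorem Ideal.span_image_range_mono (x : ℕ → B) {i j : ℕ} (h : i ≤ j) :
    Ideal.span (x '' (range i : Set ℕ)) ≤ Ideal.span (x '' (range j : Set ℕ)) :=
  Ideal.span_mono (Set.image_mono (by simpa using h))

/-- The coefficients of a relation on a weakly regular sequence lie in the ideal that the
sequence generates. -/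
theorem mem_span_of_sum_mul_eq_zero {x : ℕ → B} {n : ℕ}
    (hreg : ∀ i < n, ∀ y, y * x i ∈ Ideal.span (x '' (range i : Set ℕ)) →
      y ∈ Ideal.span (x '' (range i : Set ℕ))) (a : ℕ → B)
    (ha : ∑ j ∈ range n, a j * x j = 0) {j : ℕ} (hj : j < n) :
    a j ∈ Ideal.span (x '' (range n : Set ℕ)) := by
  induction n generalizing a j with
  | zero => omega
  | succ n ih =>
    have hmono := Ideal.span_image_range_mono x n.le_succ
    rw [sum_range_succ] at ha
    have han : a n ∈ Ideal.span (x '' (range n : Set ℕ)) := by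
      refine hreg n n.lt_succ_self _ ?_
      rw [eq_neg_of_add_eq_zero_right ha]
      exact Ideal.neg_mem_iff _ |>.mpr (Ideal.mem_span_image_range_iff.mpr ⟨a, rfl⟩)
    rcases Nat.lt_succ_iff_lt_or_eq.mp hj with hj | rfl
    -- Substituting the expansion of `a n` in the earlier terms gives a shorter relation with
    -- coefficients `a j + c j * x n`.
    · obtain ⟨c, hc⟩ := Ideal.mem_span_image_range_iff.mp han
      have h0 : ∑ j ∈ range n, (a j + c j * x n) * x j = 0 := by
        rw [← ha, ← hc, sum_mul, ← sum_add_distrib]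
        exact sum_congr rfl fun j _ => by ring
      have h1 := hmono (ih (fun i hi => hreg i (hi.trans n.lt_succ_self)) _ h0 hj)
      have hxn : x n ∈ Ideal.span (x '' (range (n + 1) : Set ℕ)) :=
        Ideal.subset_span ⟨n, by simp, rfl⟩
      have h2 := Ideal.sub_mem _ h1 (Ideal.mul_mem_left _ (c j) hxn)
      rwa [add_sub_cancel_right] at h2
    · exact hmono han

theorem Ideal.exists_sum_eq_of_mem_mul_span {K : Ideal B} {x : ℕ → B} {n : ℕ} {z : B}
    (hz : z ∈ K * Ideal.span (x '' (range n : Set ℕ))) :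
    ∃ c : ℕ → B, (∀ j, c j ∈ K) ∧ ∑ j ∈ range n, c j * x j = z := by
  induction hz using Submodule.mul_induction_on' with
  | mem_mul_mem u hu v hv =>
    obtain ⟨c, rfl⟩ := Ideal.mem_span_image_range_iff.mp hv
    refine ⟨fun j => u * c j, fun j => K.mul_mem_right _ hu, ?_⟩
    rw [mul_sum]
    exact sum_congr rfl fun j _ => by ring
  | add u _ v _ hu hv =>
    obtain ⟨c, hc, rfl⟩ := hu
    obtain ⟨c', hc', rfl⟩ := hv
    refine ⟨fun j => c j + c' j, fun j => K.add_mem (hc j) (hc' j), ?_⟩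
    rw [← sum_add_distrib]
    exact sum_congr rfl fun j _ => by ring

/-- Adjoining `x 0, …, x (n-1)` to `K²` one at a time climbs to `K`. Each step contributes `λ(B/K)`,
because the colon ideal is always `K`. -/
theorem Ideal.colength_sq_span_eq {x : ℕ → B} {n : ℕ}
    (hreg : ∀ i < n, ∀ y, y * x i ∈ Ideal.span (x '' (range i : Set ℕ)) →
      y ∈ Ideal.span (x '' (range i : Set ℕ))) :
    (Ideal.span (x '' (range n : Set ℕ)) ^ 2).colength =
      (n + 1) * (Ideal.span (x '' (range n : Set ℕ))).colength := by
  set K := Ideal.span (x '' (range n : Set ℕ)) with hK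
  have hcolon : ∀ i < n, (K ^ 2 ⊔ Ideal.span (x '' (range i : Set ℕ))).colon {x i} = K := by
    intro i hi
    apply le_antisymm
    · intro y hy
      obtain ⟨u, hu, v, hv, huv⟩ := Submodule.mem_sup.mp (Submodule.mem_colon_singleton.mp hy)
      rw [pow_two] at hu
      obtain ⟨c, hcK, rfl⟩ := Ideal.exists_sum_eq_of_mem_mul_span hu
      obtain ⟨b, rfl⟩ := Ideal.mem_span_image_range_iff.mp hv
      -- The equation for `y * x i` becomes a relation whose `i`-th coefficient is `c i - y`. That
      -- coefficient lies in `K`, as does `c i`, hence so does `y`.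
      let a : ℕ → B := fun j => c j + (if j < i then b j else 0) - (if j = i then y else 0)
      have ha : ∑ j ∈ range n, a j * x j = 0 := by
        simp only [a, sub_mul, add_mul, sum_sub_distrib, sum_add_distrib, ite_mul, zero_mul,
          sum_ite_eq', mem_range, hi, if_true]
        rw [sub_eq_zero, ← smul_eq_mul y, ← huv, ← sum_filter]
        congr 2
        ext j
        simp only [mem_filter, mem_range]
        omega
      have h := mem_span_of_sum_mul_eq_zero hreg a ha hi
      simp only [a, lt_irrefl, if_false, add_zero, if_true] at h
      have h2 := K.sub_mem (hcK i) h
      rwa [sub_sub_cancel] at h2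
    · intro y hy
      refine Submodule.mem_colon_singleton.mpr (Ideal.mem_sup_left ?_)
      rw [pow_two]
      exact Ideal.mul_mem_mul hy (Ideal.subset_span ⟨i, by simpa using hi, rfl⟩)
  have hstep : ∀ i ≤ n, (K ^ 2).colength =
      i * K.colength + (K ^ 2 ⊔ Ideal.span (x '' (range i : Set ℕ))).colength := by
    intro i hi
    induction i with
    | zero => simp
    | succ i ih =>
      rw [ih (by omega),
        Ideal.colength_eq_colon_add_sup (K ^ 2 ⊔ Ideal.span (x '' (range i : Set ℕ))) (x i), hcolon i (by omega), sup_assoc,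
        ← Ideal.span_union, range_add_one, coe_insert, Set.image_insert_eq, Set.union_comm,
        Set.singleton_union]
      push_cast
      ring
  rw [hstep n le_rfl, ← hK, sup_eq_right.mpr (Ideal.pow_le_self two_ne_zero)]
  ring

theorem Ideal.ofList_take_eq_span_image_range (rs : List B) {i : ℕ} (hi : i ≤ rs.length) :
    Ideal.ofList (rs.take i) = Ideal.span ((fun j => rs.getD j 0) '' (range i : Set ℕ)) := by
  refine congrArg Ideal.span (Set.ext fun r => ?_)
  simp only [Set.mem_ofPred_eq, Set.mem_image, coe_range, Set.mem_Iio, List.mem_take_iff_getElem]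
  constructor
  · rintro ⟨j, hj, rfl⟩
    refine ⟨j, by omega, ?_⟩
    rw [List.getD_eq_getElem _ _ (by omega)]
  · rintro ⟨j, hj, rfl⟩
    refine ⟨j, by omega, ?_⟩
    rw [List.getD_eq_getElem _ _ (by omega)]

theorem RingTheory.Sequence.IsWeaklyRegular.colength_sq_ofList {rs : List B}
    (h : RingTheory.Sequence.IsWeaklyRegular B rs) :
    (Ideal.ofList rs ^ 2).colength = (rs.length + 1) * (Ideal.ofList rs).colength := by
  have hK := Ideal.ofList_take_eq_span_image_range rs le_rfl
  rw [List.take_length] at hK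
  rw [hK]
  refine Ideal.colength_sq_span_eq fun i hi y hy => ?_
  rw [← Ideal.ofList_take_eq_span_image_range rs hi.le] at hy ⊢
  have hr := h.regular_mod_prev i hi
  rw [isSMulRegular_quotient_iff_mem_of_smul_mem] at hr
  have h1 := hr y
  simp only [smul_eq_mul, Ideal.mul_top] at h1
  refine h1 ?_
  rwa [List.getD_eq_getElem _ _ hi, mul_comm] at hy

end RegularSequence

/-! ### Comparison of `I` and `I²` -/

namespace Ideal

variable {R : Type*} [CommRing R]

theorem ringKrullDim_quotient_pow (I : Ideal R) {n : ℕ} (hn : n ≠ 0) :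
    ringKrullDim (R ⧸ I ^ n) = ringKrullDim (R ⧸ I) := by
  rw [ringKrullDim_quotient, ringKrullDim_quotient, PrimeSpectrum.zeroLocus_pow I hn]

theorem HasHilbertSamuelLimit.hasHilbertSamuelMultiplicity [IsLocalRing R] [IsNoetherianRing R]
    {J : Ideal R} [IsLocalRing (R ⧸ J)] {d : ℕ} {e : ℝ} (h : HasHilbertSamuelLimit d J e)
    (hd : ringKrullDim (R ⧸ J) = d) :
    HasHilbertSamuelMultiplicity (R ⧸ J) (d.factorial * e) := by
  have h1 : ((ringKrullDim (R ⧸ J)).unbotD 0).toNat = d := by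
    rw [hd]
    rfl
  refine (Tendsto.const_mul (d.factorial : ℝ) h).congr fun n => ?_
  simp only [hilbertSamuelQuotient, h1, length_quotient_maximalIdeal_pow]
  rw [hilbertSamuelFunction, mul_div_assoc]

theorem minimalPrimes_subset_associatedPrimes_quotient [IsNoetherianRing R] (I : Ideal R) :
    I.minimalPrimes ⊆ associatedPrimes R (R ⧸ I) := by
  have := Module.associatedPrimes.minimalPrimes_annihilator_subset_associatedPrimes R (R ⧸ I)
  rwa [Ideal.annihilator_quotient] at this

theorem ringKrullDim_localization_quotient_map_eq_zero [IsNoetherianRing R] {I p : Ideal R} [p.IsPrime]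
    (hp : p ∈ I.minimalPrimes) :
    ringKrullDim (Localization.AtPrime p ⧸ I.map (algebraMap R (Localization.AtPrime p))) = 0 := by
  have hmin : IsLocalRing.maximalIdeal (Localization.AtPrime p) ∈
      (I.map (algebraMap R (Localization.AtPrime p))).minimalPrimes := by
    rw [IsLocalization.minimalPrimes_map p.primeCompl]
    change (IsLocalRing.maximalIdeal (Localization.AtPrime p)).under R ∈ I.minimalPrimes
    rwa [Localization.AtPrime.under_maximalIdeal]
  have := IsLocalRing.quotient_artinian_of_mem_minimalPrimes_of_isLocalRing _ hmin
  have : Nontrivial (Localization.AtPrime p ⧸ I.map (algebraMap R (Localization.AtPrime p))) :=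
    Ideal.Quotient.nontrivial_iff.mpr fun h =>
      (IsLocalRing.maximalIdeal.isMaximal _).ne_top (top_le_iff.mp (h ▸ hmin.1.2))
  exact ringKrullDimZero_iff_ringKrullDim_eq_zero.mp inferInstance

/-- By the dimension formula, maximal dimension of `R/P` among the minimal primes of `I` means
minimal height. -/
theorem height_eq_of_mem_minimalPrimesOfDim [IsNoetherianRing R] [IsLocalRing R]
    (hequi : IsEquidimensionalRing R) (hcat : IsCatenaryRing R) {I : Ideal R} {d : ℕ}
    (hd : ringKrullDim (R ⧸ I) = d) {P : PrimeSpectrum R} (hP : P ∈ I.minimalPrimesOfDim d) :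
    P.asIdeal.height = I.height := by
  refine le_antisymm ?_ (Ideal.height_mono hP.1.1.2)
  rw [I.height_eq_inf_minimalPrimes]
  refine le_iInf₂ fun J hJ => ?_
  have hdim : ringKrullDim (R ⧸ J) ≤ d :=
    (ringKrullDim_le_of_surjective _ (Ideal.Quotient.factor_surjective hJ.1.2)).trans hd.le
  have h := (hcat.height_add_ringKrullDim_quotient hequi P).trans
    (hcat.height_add_ringKrullDim_quotient hequi ⟨J, hJ.1.1⟩).symm
  rw [hP.2] at h
  have h1 : (P.asIdeal.height : WithBot ℕ∞) + (d : ℕ∞) ≤ (J.height : WithBot ℕ∞) + (d : ℕ∞) :=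
    h.le.trans (add_le_add_right hdim _)
  have h2 : P.asIdeal.height + (d : ℕ∞) ≤ J.height + (d : ℕ∞) := by exact_mod_cast h1
  exact (WithTop.add_le_add_iff_right (ENat.natCast_ne_top d)).mp h2

theorem localColength_sq [IsNoetherianRing R] {I : Ideal R}
    (hI : I.IsGenericallyCompleteIntersection) {P : PrimeSpectrum R}
    (hP : P.asIdeal ∈ I.minimalPrimes) {c : ℕ} (hc : P.asIdeal.height = c) :
    localColength P (I ^ 2) = (c + 1) * localColength P I := by
  obtain ⟨rs, hreg, hrs⟩ := hI P.asIdeal (minimalPrimes_subset_associatedPrimes_quotient I hP)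
  have hlen : rs.length = c := by
    -- The quotient `R_P/I_P` has dimension zero, so the regular sequence has length `dim R_P = c`.
    have h1 := ringKrullDim_add_length_eq_ringKrullDim_of_isRegular rs hreg
    rw [hrs, ringKrullDim_localization_quotient_map_eq_zero hP, zero_add,
      IsLocalization.AtPrime.ringKrullDim_eq_height P.asIdeal, hc] at h1
    exact_mod_cast h1
  rw [localColength, localColength, Ideal.map_pow, ← hrs, hreg.toIsWeaklyRegular.colength_sq_ofList,
    hlen]

end Ideal

theorem proposition1p9 {R : Type*} [CommRing R] [IsNoetherianRing R] [IsLocalRing R]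
    (hequi : IsEquidimensionalRing R) (hcat : IsCatenaryRing R)
    (I : Ideal R) (hI : I.IsGenericallyCompleteIntersection)
    (c : ℕ) (hc : I.height = c) :
    haveI : IsLocalRing (R ⧸ I) :=
      Ideal.isLocalRing_quotient (Ideal.ne_top_of_height_eq_natCast hc)
    haveI : IsLocalRing (R ⧸ I ^ 2) :=
      Ideal.isLocalRing_quotient (Ideal.sq_ne_top (Ideal.ne_top_of_height_eq_natCast hc))
    HasHilbertSamuelMultiplicity (R ⧸ I) (hilbertSamuelMultiplicity (R ⧸ I)) ∧
      HasHilbertSamuelMultiplicity (R ⧸ I ^ 2) (hilbertSamuelMultiplicity (R ⧸ I ^ 2)) ∧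
      hilbertSamuelMultiplicity (R ⧸ I ^ 2) = (c + 1) * hilbertSamuelMultiplicity (R ⧸ I) := by
  have : IsLocalRing (R ⧸ I) := Ideal.isLocalRing_quotient (Ideal.ne_top_of_height_eq_natCast hc)
  have : IsLocalRing (R ⧸ I ^ 2) :=
    Ideal.isLocalRing_quotient (Ideal.sq_ne_top (Ideal.ne_top_of_height_eq_natCast hc))
  obtain ⟨d, hd⟩ : ∃ d : ℕ, ringKrullDim (R ⧸ I) = d := by
    obtain ⟨a, ha⟩ := WithBot.ne_bot_iff_exists.mp (ringKrullDim_ne_bot (R := R ⧸ I))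
    have htop : a ≠ ⊤ := fun h => ringKrullDim_ne_top (R := R ⧸ I) (by rw [← ha, h]; rfl)
    obtain ⟨d, rfl⟩ := ENat.ne_top_iff_exists.mp htop
    exact ⟨d, ha.symm⟩
  have hd2 : ringKrullDim (R ⧸ I ^ 2) = d := by
    rw [Ideal.ringKrullDim_quotient_pow I two_ne_zero, hd]
  have hmin : (I ^ 2).minimalPrimesOfDim d = I.minimalPrimesOfDim d := by
    rw [Ideal.minimalPrimesOfDim, Ideal.minimalPrimesOfDim, ← Ideal.radical_minimalPrimes,
      Ideal.radical_pow I two_ne_zero, Ideal.radical_minimalPrimes]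
  -- Basing the formula at `I ^ 2` makes the same weights serve both `I` and `I ^ 2`.
  obtain ⟨e, he⟩ := Ideal.exists_hasHilbertSamuelLimit_sum (I ^ 2) d hd2.le
  have h1 := (he I (Ideal.pow_le_self two_ne_zero)).2.hasHilbertSamuelMultiplicity hd
  have h2 := (he (I ^ 2) le_rfl).2.hasHilbertSamuelMultiplicity hd2
  have e1 : hilbertSamuelMultiplicity (R ⧸ I) = _ := h1.limUnder_eq
  have e2 : hilbertSamuelMultiplicity (R ⧸ I ^ 2) = _ := h2.limUnder_eq
  refine ⟨e1 ▸ h1, e2 ▸ h2, ?_⟩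
  rw [e1, e2, mul_left_comm, Finset.mul_sum _ _ ((c : ℝ) + 1)]
  congr 1
  refine Finset.sum_congr rfl fun P hP => ?_
  rw [Set.Finite.mem_toFinset, hmin] at hP
  rw [Ideal.localColength_sq hI hP.1
    ((Ideal.height_eq_of_mem_minimalPrimesOfDim hequi hcat hd hP).trans hc), ENat.toNat_mul]
  have : ((c : ℕ∞) + 1).toNat = c + 1 := by
    rw [← Nat.cast_one, ← Nat.cast_add, ENat.toNat_natCast]
  rw [this]
  push_cast
  ring
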